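/- Let $G_1$ be an abelian group (written multiplicatively) and $G_2$ a finite group acting trivially on $G_1$. A normalized 2-cocycle is a map $\varepsilon : G_2\times G_2\to G_1$ with $\varepsilon(g,1)=\varepsilon(1,g)=1$ and $\varepsilon(h,g)\,\varepsilon(hg,k)=\varepsilon(g,k)\,\varepsilon(h,gk)$ for all $g,h,k\in G_2$; the set of these is $Z^2(G_2,G_1)$. For $\varepsilon\in Z^2(G_2,G_1)$, the perturbed direct product $G_1\times_{\varepsilon}G_2$ is the group with underlying set $G_1\times G_2$ and multiplication $(x,y)(x',y')=(xx'\varepsilon(y,y'),\,yy')$; identify $G_1$ with its subgroup $\{(x,1):x\in G_1\}$. For a group $G$ let $\mathcal{A}(G)$ be the set of commuting automorphisms of $G$, i.e. those $\rho\in\mathrm{Aut}(G)$ such that $\rho(x)$ commutes with $x$ for every $x\in G$, and let $\mathrm{Aut}_c(G)$ be the group of central automorphisms of $G$, i.e. those inducing the identity on $G/Z(G)$. For $\varepsilon_1,\varepsilon_2\in Z^2(G_2,G_1)$, call $G_1\times_{\varepsilon_1}G_2$ and $G_1\times_{\varepsilon_2}G_2$ upper $\mathcal{A}$-isomorphic (respectively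 upper $c$-isomorphic) if there is a group isomorphism $\varphi: G_1\times_{\varepsilon_1}G_2\to G_1\times_{\varepsilon_2}G_2$ such that $\varphi(G_1)=G_1$ and the map $\varphi_{22}:G_2\to G_2$ sending $y$ to the second coordinate of $\varphi(1,y)$ belongs to $\mathcal{A}(G_2)$ (respectively to $\mathrm{Aut}_c(G_2)$). Suppose that for every prime $p$ dividing $|G_2|$, every Sylow $p$-subgroup $P$ of $G_2$ is of maximal class (that is, $|P|=p^n$ and $P$ has nilpotency class $n-1$ for some $n\ge 2$) and satisfies $\log_p|P|\ge 4$. Then for all $\varepsilon_1,\varepsilon_2\in Z^2(G_2,G_1)$, the groups $G_1\times_{\varepsilon_1}G_2$ and $G_1\times_{\varepsilon_2}G_2$ are upper $\mathcal{A}$-isomorphic if and only if they are upper $c$-isomorphic. -/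

import Mathlib

universe u v

/-- Normalized 2-cocycles of `G₂` with coefficients in the abelian group `G₁` (written
multiplicatively), where `G₂` acts trivially on `G₁`. -/
structure NormalizedTwoCocycle (G₂ : Type v) (G₁ : Type u) [Group G₂] [CommGroup G₁] where
  /-- the underlying map `G₂ × G₂ → G₁` -/
  toFun : G₂ → G₂ → G₁
  map_one_left : ∀ y, toFun 1 y = 1
  map_one_right : ∀ y, toFun y 1 = 1
  cocycle : ∀ x y z, toFun x y * toFun (x * y) z = toFun y z * toFun x (y * z)

/-- The perturbed direct product of `G₁` and `G₂` under `ε`: its underlying set is `G₁ × G₂`. -/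
@[ext]
structure PerturbedProduct {G₁ : Type u} {G₂ : Type v} [CommGroup G₁] [Group G₂]
    (ε : NormalizedTwoCocycle G₂ G₁) where
  /-- the first coordinate -/
  fst : G₁
  /-- the second coordinate -/
  snd : G₂

namespace PerturbedProduct

section Basic

variable {G₁ : Type u} {G₂ : Type v} [CommGroup G₁] [Group G₂] {ε : NormalizedTwoCocycle G₂ G₁}

/-- `(x, y) · (x', y') = (x x' ε(y, y'), y y')`. -/
instance : Mul (PerturbedProduct ε) :=
  ⟨fun a b => ⟨a.fst * b.fst * ε.toFun a.snd b.snd, a.snd * b.snd⟩⟩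

instance : One (PerturbedProduct ε) := ⟨⟨1, 1⟩⟩

instance : Inv (PerturbedProduct ε) :=
  ⟨fun a => ⟨a.fst⁻¹ * (ε.toFun a.snd⁻¹ a.snd)⁻¹, a.snd⁻¹⟩⟩

@[simp] theorem mul_fst (a b : PerturbedProduct ε) :
    (a * b).fst = a.fst * b.fst * ε.toFun a.snd b.snd := rfl

@[simp] theorem mul_snd (a b : PerturbedProduct ε) : (a * b).snd = a.snd * b.snd := rfl

@[simp] theorem one_fst : (1 : PerturbedProduct ε).fst = 1 := rfl

@[simp] theorem one_snd : (1 : PerturbedProduct ε).snd = 1 := rfl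

@[simp] theorem inv_fst (a : PerturbedProduct ε) :
    a⁻¹.fst = a.fst⁻¹ * (ε.toFun a.snd⁻¹ a.snd)⁻¹ := rfl

@[simp] theorem inv_snd (a : PerturbedProduct ε) : a⁻¹.snd = a.snd⁻¹ := rfl

instance : Group (PerturbedProduct ε) :=
  Group.ofLeftAxioms
    (by
      intro a b c
      ext
      · have h := ε.cocycle a.snd b.snd c.snd
        simp only [mul_fst, mul_snd]
        calc a.fst * b.fst * ε.toFun a.snd b.snd * c.fst * ε.toFun (a.snd * b.snd) c.snd
            = a.fst * b.fst * c.fst *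
                (ε.toFun a.snd b.snd * ε.toFun (a.snd * b.snd) c.snd) := by
              simp only [mul_assoc, mul_comm, mul_left_comm]
          _ = a.fst * b.fst * c.fst *
                (ε.toFun b.snd c.snd * ε.toFun a.snd (b.snd * c.snd)) := by rw [h]
          _ = _ := by simp only [mul_assoc]
      · simp [mul_assoc])
    (by intro a; ext <;> simp [ε.map_one_left])
    (by intro a; ext <;> simp)

variable (ε) in
/-- The copy `{(x, 1) : x ∈ G₁}` of `G₁` inside the perturbed direct product. -/
def kernelSubgroup : Subgroup (PerturbedProduct ε) where
  carrier := {a | a.snd = 1}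
  mul_mem' := by
    intro a b ha hb
    simp only [Set.mem_ofPred_eq] at ha hb ⊢
    simp [ha, hb]
  one_mem' := rfl
  inv_mem' := by
    intro a ha
    simp only [Set.mem_ofPred_eq] at ha ⊢
    simp [ha]

end Basic

end PerturbedProduct

/-- The set `𝒜(G)` of commuting automorphisms: `ρ(x)` commutes with `x` for all `x`. -/
def commutingAut (G : Type u) [Group G] : Set (MulAut G) :=
  {ρ | ∀ x : G, Commute (ρ x) x}

/-- The set `Aut_c(G)` of central automorphisms: those inducing the identity on `G / Z(G)`. -/
def centralAut (G : Type u) [Group G] : Set (MulAut G) :=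
  {ρ | ∀ x : G, (QuotientGroup.mk (ρ x) : G ⧸ Subgroup.center G) = QuotientGroup.mk x}

/-- The entry `φ₂₂ = pr₂ ∘ φ ∘ t₂` of the matrix form of an isomorphism of perturbed direct
products, where `t₂(y) = (1, y)`. -/
def entry22 {G₁ : Type u} {G₂ : Type v} [CommGroup G₁] [Group G₂]
    {ε₁ ε₂ : NormalizedTwoCocycle G₂ G₁}
    (φ : PerturbedProduct ε₁ ≃* PerturbedProduct ε₂) (y : G₂) : G₂ :=
  (φ ⟨1, y⟩).snd

/-- `G₁ ×_{ε₁} G₂` and `G₁ ×_{ε₂} G₂` are isomorphic by an isomorphism `φ` that leaves `G₁`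
invariant and whose entry `φ₂₂` is an automorphism of `G₂` belonging to the set `S`. -/
def UpperIsomorphicVia {G₁ : Type u} {G₂ : Type v} [CommGroup G₁] [Group G₂]
    (S : Set (MulAut G₂)) (ε₁ ε₂ : NormalizedTwoCocycle G₂ G₁) : Prop :=
  ∃ φ : PerturbedProduct ε₁ ≃* PerturbedProduct ε₂,
    (PerturbedProduct.kernelSubgroup ε₁).map φ.toMonoidHom = PerturbedProduct.kernelSubgroup ε₂ ∧
    ∃ ρ ∈ S, ∀ y : G₂, entry22 φ y = ρ y

/-- Upper `𝒜`-isomorphic. -/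
def UpperAIsomorphic {G₁ : Type u} {G₂ : Type v} [CommGroup G₁] [Group G₂]
    (ε₁ ε₂ : NormalizedTwoCocycle G₂ G₁) : Prop :=
  UpperIsomorphicVia (commutingAut G₂) ε₁ ε₂

/-- Upper `c`-isomorphic. -/
def UpperCIsomorphic {G₁ : Type u} {G₂ : Type v} [CommGroup G₁] [Group G₂]
    (ε₁ ε₂ : NormalizedTwoCocycle G₂ G₁) : Prop :=
  UpperIsomorphicVia (centralAut G₂) ε₁ ε₂

/-- `P` is a finite `p`-group of maximal class: `|P| = p ^ n` and `P` has nilpotency class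
`n - 1`, for some `n`. (As `P` is then nontrivial, its class is positive and so `n ≥ 2`.) -/
def IsOfMaximalClass (p : ℕ) (P : Type u) [Group P] : Prop :=
  ∃ _ : Group.IsNilpotent P, Nat.card P = p ^ (Group.nilpotencyClass P + 1)

/-!
A central automorphism is commuting, so the content is the converse for the given `G = G₂`: every
commuting automorphism `ρ` is central.  Write `d x = x⁻¹ ρ(x)`.

For an arbitrary group, `ρ(xy)` commuting with `xy` yields
`ρ(x)⁻¹ y ρ(x) · d y = x⁻¹ ρ(y) x`.  Applying this to products and to conjugates of `y` shows that
`d (g⁻¹ y g)` and `d y` agree modulo the center, hence that `d y` commutes with every conjugate of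
`y` (`commute_div_conj`).  Consequently `d y` also commutes with its own conjugates, so its normal
closure is abelian.

Now let `G` be finite and `x` an element of a Sylow `p`-subgroup `P`.  The normal closure of `d x`
is a `p`-group, so it lies in `P`, and `ρ` maps `P` to itself.  An element `y` of `q`-power order
with `q ≠ p` commutes with its conjugate by `d x`, so the commutator of `y` and `d x` is both a
`p`-element and a `q`-element, and is therefore trivial.  It remains to see that `d x` is central
in `P`.

If `P` is of maximal class and has order at least `p ^ 4`, then `Z(P/Z(P))` has order `p`
(`IsOfMaximalClass.card_center_quotient`).  Fix a noncentral `w` in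
the second center of `P`.  If `x` does not commute with `w` and
`d x` is not in `Z(P)`, then the centralizer of the normal closure of `x` is a normal subgroup not
contained in `Z(P)`; modulo `Z(P)` it meets, hence contains, the group `Z(P/Z(P))` of prime order,
which forces `x` to commute with `w`, a contradiction.  So `d x ∈ Z(P)` for all `x` outside the
proper subgroup `C_P(w)`, and these elements generate `P`.  Therefore `d x` commutes with a Sylow
subgroup for every prime, that is, with all of `G`.
-/

/-! ### Commuting automorphisms of arbitrary groups -/

section Commuting

variable {G : Type u} [Group G] {ρ : MulAut G}

/-- The condition that `ρ (x * y)` commutes with `x * y`, rewritten in terms of conjugates of `y`. -/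
theorem commutingAut.conj_mul_div (h : ρ ∈ commutingAut G) (x y : G) :
    (ρ x)⁻¹ * y * ρ x * (y⁻¹ * ρ y) = x⁻¹ * ρ y * x := by
  have hx : ρ x * x = x * ρ x := h x
  have hy : ρ y * y = y * ρ y := h y
  have hxy : ρ x * ρ y * (x * y) = x * y * (ρ x * ρ y) := by simpa using (h (x * y)).eq
  have hy' : y⁻¹ * ρ y = ρ y * y⁻¹ := by
    rw [inv_mul_eq_iff_eq_mul, ← mul_assoc, ← hy, mul_inv_cancel_right]
  refine mul_left_cancel (a := x * ρ x) ?_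
  calc x * ρ x * ((ρ x)⁻¹ * y * ρ x * (y⁻¹ * ρ y))
      = x * y * (ρ x * ρ y) * y⁻¹ := by rw [hy']; group
    _ = ρ x * x * (x⁻¹ * ρ y * x) := by rw [← hxy]; group
    _ = _ := by rw [hx]

/-- The displacement `y⁻¹ ρ(y)` commutes with every conjugate of `y`, because the displacements of
conjugate elements agree modulo the center. -/
theorem commutingAut.commute_div_conj (h : ρ ∈ commutingAut G) (y g : G) :
    Commute (y⁻¹ * ρ y) (g⁻¹ * y * g) := by
  obtain ⟨x, rfl⟩ := ρ.surjective g
  -- As `ρ` is surjective, `w` is an arbitrary conjugate of `y`.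
  set w := (ρ x)⁻¹ * y * ρ x with hw
  have hwd : Commute (w⁻¹ * ρ w) w := ((Commute.refl w).inv_left).mul_left (h w)
  have hcentral : ∀ t, Commute t ((w⁻¹ * ρ w)⁻¹ * (y⁻¹ * ρ y)) := by
    intro t
    have h1 := commutingAut.conj_mul_div h t w
    have h2 := commutingAut.conj_mul_div h (x * t) y
    have h3 := commutingAut.conj_mul_div h x y
    rw [← hw] at h3
    have h4 : (ρ t)⁻¹ * w * ρ t * (y⁻¹ * ρ y) = t⁻¹ * (w * (y⁻¹ * ρ y)) * t := by
      rw [h3]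
      calc _ = (ρ (x * t))⁻¹ * y * ρ (x * t) * (y⁻¹ * ρ y) := by
            rw [hw, map_mul]; group
        _ = _ := by rw [h2]; group
    have h5 : (ρ t)⁻¹ * w * ρ t = t⁻¹ * ρ w * t * (w⁻¹ * ρ w)⁻¹ := by
      rw [← h1, mul_inv_cancel_right]
    rw [h5] at h4
    have h6 : t⁻¹ * ρ w * (t * ((w⁻¹ * ρ w)⁻¹ * (y⁻¹ * ρ y))) =
        t⁻¹ * ρ w * (((w⁻¹ * ρ w)⁻¹ * (y⁻¹ * ρ y)) * t) := by
      calc _ = t⁻¹ * ρ w * t * (w⁻¹ * ρ w)⁻¹ * (y⁻¹ * ρ y) := by simp only [mul_assoc]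
        _ = _ := by rw [h4]; group
    exact mul_left_cancel h6
  have := hwd.mul_left (hcentral w).symm
  rwa [mul_inv_cancel_left] at this

theorem commutingAut.commute_div_conj_div (h : ρ ∈ commutingAut G) (y g : G) :
    Commute (y⁻¹ * ρ y) (g⁻¹ * (y⁻¹ * ρ y) * g) := by
  have h1 : g⁻¹ * (y⁻¹ * ρ y) * g =
      (g⁻¹ * y * g)⁻¹ * ((ρ g)⁻¹ * y * ρ g * (y⁻¹ * ρ y)) := by
    rw [commutingAut.conj_mul_div h]; group
  rw [h1]
  exact (commutingAut.commute_div_conj h y g).inv_right.mul_right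
    ((commutingAut.commute_div_conj h y (ρ g)).mul_right (Commute.refl _))

/-- Every element commutes with its conjugate by a displacement `x⁻¹ ρ(x)`. -/
theorem commutingAut.commute_conj_div (h : ρ ∈ commutingAut G) (x y : G) :
    Commute y ((x⁻¹ * ρ x)⁻¹ * y * (x⁻¹ * ρ x)) := by
  have h1 : (ρ x)⁻¹ * y * ρ x = x⁻¹ * ρ y * x * (y⁻¹ * ρ y)⁻¹ := by
    rw [← commutingAut.conj_mul_div h, mul_inv_cancel_right]
  have h2 : Commute (x⁻¹ * y * x) ((ρ x)⁻¹ * y * ρ x) := by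
    rw [h1]
    refine Commute.mul_right ?_ (commutingAut.commute_div_conj h y x).symm.inv_right
    simpa using ((Commute.conj_iff x⁻¹).2 (h y)).symm
  have h3 := (Commute.conj_iff x).2 h2
  have h4 : x⁻¹ * ρ x = ρ x * x⁻¹ := by
    rw [inv_mul_eq_iff_eq_mul, ← mul_assoc, ← (h x).eq, mul_inv_cancel_right]
  rw [h4]
  convert h3 using 1 <;> group

end Commuting

/-! ### Normal closures consisting of elements of prime power order -/

theorem isPGroup_normalClosure_singleton {G : Type*} [Group G] {p k : ℕ} {b : G}
    (hb : b ^ p ^ k = 1) (hcomm : ∀ g : G, Commute b (g⁻¹ * b * g)) :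
    IsPGroup p (Subgroup.normalClosure {b}) := by
  have hc : ∀ x ∈ Group.conjugatesOfSet {b}, ∀ y ∈ Group.conjugatesOfSet {b}, x * y = y * x := by
    intro x hx y hy
    simp only [Group.mem_conjugatesOfSet_iff, Set.mem_singleton_iff, exists_eq_left,
      isConj_iff] at hx hy
    obtain ⟨c, rfl⟩ := hx
    obtain ⟨e, rfl⟩ := hy
    have := (Commute.conj_iff c).2 (hcomm (e⁻¹ * c))
    change Commute _ _
    convert this using 1
    group
  have hcl := Subgroup.isMulCommutative_closure hc
  rintro ⟨x, hx⟩
  -- In the abelian normal closure the exponent of the generator bounds all exponents.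
  refine ⟨k, Subtype.ext ?_⟩
  change x ^ p ^ k = 1
  unfold Subgroup.normalClosure at hx
  induction hx using Subgroup.closure_induction with
  | mem x hx =>
    simp only [Group.mem_conjugatesOfSet_iff, Set.mem_singleton_iff, exists_eq_left,
      isConj_iff] at hx
    obtain ⟨c, rfl⟩ := hx
    rw [conj_pow, hb]
    simp
  | one => simp
  | mul x y hx hy ihx ihy =>
    have hxy : Commute x y := by
      have := mul_comm' (⟨x, hx⟩ : Subgroup.closure (Group.conjugatesOfSet {b})) ⟨y, hy⟩
      exact congrArg Subtype.val this
    rw [hxy.mul_pow, ihx, ihy, one_mul]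
  | inv x hx ih => rw [inv_pow, ih, inv_one]

/-! ### Commuting automorphisms and Sylow subgroups -/

section Sylow

variable {G : Type u} [Group G] {ρ : MulAut G}

theorem commutingAut.isPGroup_normalClosure_div (h : ρ ∈ commutingAut G) {p k : ℕ} {x : G}
    (hx : x ^ p ^ k = 1) : IsPGroup p (Subgroup.normalClosure {x⁻¹ * ρ x}) := by
  refine isPGroup_normalClosure_singleton (k := k) ?_ (commutingAut.commute_div_conj_div h x)
  have : Commute x⁻¹ (ρ x) := (h x).symm.inv_left
  rw [this.mul_pow, inv_pow, ← map_pow, hx]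
  simp

theorem commutingAut.div_mem_sylow (h : ρ ∈ commutingAut G) {p : ℕ} (P : Sylow p G) {x : G}
    (hx : x ∈ P) : x⁻¹ * ρ x ∈ P := by
  obtain ⟨k, hk⟩ := P.isPGroup' ⟨x, hx⟩
  have hN := commutingAut.isPGroup_normalClosure_div h (congrArg Subtype.val hk)
  exact hN.le_sylow_of_normal P (Subgroup.subset_normalClosure rfl)

/-- The commutator of `y` and `x⁻¹ ρ(x)` lies in a normal `p`-group and is a product of two commuting
elements whose orders are powers of `q`. -/
theorem commutingAut.commute_div_of_coprime (h : ρ ∈ commutingAut G) {p q k l : ℕ}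
    (hpq : p.Coprime q) {x y : G} (hx : x ^ p ^ k = 1) (hy : y ^ q ^ l = 1) :
    Commute (x⁻¹ * ρ x) y := by
  set a := x⁻¹ * ρ x with ha
  have hN := commutingAut.isPGroup_normalClosure_div h hx
  rw [← ha] at hN
  have haN : a ∈ Subgroup.normalClosure {a} := Subgroup.subset_normalClosure rfl
  have hmem : y⁻¹ * (a⁻¹ * y * a) ∈ Subgroup.normalClosure {a} := by
    have h1 := Subgroup.normalClosure_normal.conj_mem _ (inv_mem haN) y⁻¹
    have h2 := mul_mem h1 haN
    rw [inv_inv] at h2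
    simpa only [mul_assoc] using h2
  obtain ⟨m, hm⟩ := hN ⟨_, hmem⟩
  have hm' : (y⁻¹ * (a⁻¹ * y * a)) ^ p ^ m = 1 := congrArg Subtype.val hm
  have hq : (y⁻¹ * (a⁻¹ * y * a)) ^ q ^ l = 1 := by
    have hc : Commute y⁻¹ (a⁻¹ * y * a) := (commutingAut.commute_conj_div h x y).inv_left
    have hconj : (a⁻¹ * y * a) ^ q ^ l = a⁻¹ * y ^ q ^ l * a := by
      simpa using conj_pow (a := a⁻¹) (b := y) (i := q ^ l)
    rw [hc.mul_pow, hconj, inv_pow, hy]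
    simp
  have hone : y⁻¹ * (a⁻¹ * y * a) = 1 := by
    rw [← orderOf_eq_one_iff]
    exact Nat.eq_one_of_dvd_coprimes (hpq.pow m l) (orderOf_dvd_of_pow_eq_one hm')
      (orderOf_dvd_of_pow_eq_one hq)
  rw [inv_mul_eq_one, mul_assoc, eq_inv_mul_iff_mul_eq] at hone
  exact hone

theorem Subgroup.eq_top_of_forall_exists_sylow_le [Finite G] {H : Subgroup G}
    (hH : ∀ p : ℕ, p.Prime → p ∣ Nat.card G → ∃ P : Sylow p G, (P : Subgroup G) ≤ H) : H = ⊤ := by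
  rw [← Subgroup.index_eq_one]
  by_contra hne
  obtain ⟨p, hp, hdvd⟩ := Nat.exists_prime_and_dvd hne
  obtain ⟨P, hP⟩ := hH p hp (hdvd.trans H.index_dvd_card)
  have : Fact p.Prime := ⟨hp⟩
  exact P.not_dvd_index (hdvd.trans (Subgroup.index_dvd_of_le hP))

end Sylow

/-! ### Groups of maximal class -/

theorem Subgroup.Normal.exists_mem_center_of_ne_bot {G : Type*} [Group G] [Group.IsNilpotent G]
    {N : Subgroup G} (hN : N.Normal) (hne : N ≠ ⊥) :
    ∃ c ∈ N, c ≠ 1 ∧ c ∈ Subgroup.center G := by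
  classical
  -- Take the first term of the upper central series that meets `N` nontrivially.
  have hex : ∃ n, ∃ c ∈ N, c ≠ 1 ∧ c ∈ Subgroup.upperCentralSeries G n := by
    obtain ⟨c, hc, h1⟩ := N.bot_or_exists_ne_one.resolve_left hne
    exact ⟨Group.nilpotencyClass G, c, hc, h1, by simp⟩
  obtain ⟨c, hc, h1, hcn⟩ := Nat.find_spec hex
  refine ⟨c, hc, h1, ?_⟩
  rcases hn : Nat.find hex with _ | n
  · rw [hn] at hcn
    simp [h1] at hcn
  · rw [hn, Subgroup.mem_upperCentralSeries_succ_iff] at hcn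
    have hmin := Nat.find_min hex (m := n) (by omega)
    rw [Subgroup.mem_center_iff]
    intro g
    by_contra hg
    refine hmin ⟨c * g * c⁻¹ * g⁻¹, ?_, ?_, hcn g⟩
    · rw [mul_assoc, mul_assoc, ← mul_assoc g]
      exact mul_mem hc (hN.conj_mem _ (inv_mem hc) g)
    · rw [Ne, mul_inv_eq_one, mul_inv_eq_iff_eq_mul]
      exact fun h => hg h.symm

/-- In a nonabelian `p`-group the center has index at least `p ^ k`, where `k` is the nilpotency
class: each upper central quotient is nontrivial, and the last one is not cyclic. -/
theorem IsPGroup.pow_nilpotencyClass_mul_card_center_le {p : ℕ} (hp : p.Prime) {G : Type*} [Group G]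
    [Finite G] [Group.IsNilpotent G] (hG : IsPGroup p G) (hc : 2 ≤ Group.nilpotencyClass G) :
    p ^ Group.nilpotencyClass G * Nat.card (Subgroup.center G) ≤ Nat.card G := by
  have hfact : Fact p.Prime := ⟨hp⟩
  obtain ⟨k, hk⟩ : ∃ k, Group.nilpotencyClass G = k + 2 := ⟨_, (Nat.sub_add_cancel hc).symm⟩
  induction k generalizing G with
  | zero =>
    rw [Subgroup.card_eq_card_quotient_mul_card_subgroup (Subgroup.center G), hk]
    refine Nat.mul_le_mul_right _ ?_
    obtain ⟨m, hm⟩ := IsPGroup.iff_card.1 (hG.to_quotient (Subgroup.center G))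
    rw [hm]
    refine Nat.pow_le_pow_right hp.pos ?_
    by_contra! hlt
    have hcyc : IsCyclic (G ⧸ Subgroup.center G) := by
      interval_cases m
      · have := (Nat.card_eq_one_iff_unique.1 (hm.trans (pow_zero p))).1
        infer_instance
      · exact isCyclic_of_prime_card (hm.trans (pow_one p))
    have := (QuotientGroup.mk' (Subgroup.center G)).isMulCommutative_of_isCyclic_of_ker_le_center
      (QuotientGroup.ker_mk' _).le
    have := Group.IsNilpotent.nilpotencyClass_le_one_iff.2 this
    omega
  | succ k ih =>
    have hq : Group.nilpotencyClass (G ⧸ Subgroup.center G) = k + 2 := by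
      rw [Group.nilpotencyClass_quotient_center, hk]; rfl
    have hQ := hG.to_quotient (Subgroup.center G)
    have ih := ih hQ (by omega) hq
    rw [Subgroup.card_eq_card_quotient_mul_card_subgroup (Subgroup.center G), hk]
    refine Nat.mul_le_mul_right _ (le_trans ?_ ih)
    rw [hq, show k + 1 + 2 = (k + 2) + 1 from rfl, pow_succ]
    refine Nat.mul_le_mul_left _ ?_
    have hnt : Nontrivial (G ⧸ Subgroup.center G) := by
      rw [← not_subsingleton_iff_nontrivial, ← Group.nilpotencyClass_zero_iff_subsingleton]
      omega
    have := hQ.center_nontrivial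
    obtain ⟨n, hn, hcard⟩ := (hQ.to_subgroup (Subgroup.center _)).nontrivial_iff_card.1 this
    rw [hcard]
    exact Nat.le_self_pow hn.ne' p

/-- In a group of maximal class and order at least `p ^ 4`, the second center has order `p` modulo
the center. -/
theorem IsOfMaximalClass.card_center_quotient {p : ℕ} (hp : p.Prime) {P : Type*} [Group P]
    [Finite P] (h : IsOfMaximalClass p P) (hlog : 4 ≤ Nat.log p (Nat.card P)) :
    Nat.card (Subgroup.center (P ⧸ Subgroup.center P)) = p := by
  have hfact : Fact p.Prime := ⟨hp⟩
  obtain ⟨hnil, hcard⟩ := h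
  have hP : IsPGroup p P := IsPGroup.of_card hcard
  rw [hcard, Nat.log_pow hp.one_lt] at hlog
  obtain ⟨k, hk⟩ : ∃ k, Group.nilpotencyClass P = k + 3 :=
    ⟨_, (Nat.sub_add_cancel (by omega)).symm⟩
  have hq : Group.nilpotencyClass (P ⧸ Subgroup.center P) = k + 2 := by
    rw [Group.nilpotencyClass_quotient_center, hk]; rfl
  have hQ := hP.to_quotient (Subgroup.center P)
  have hntP : Nontrivial P := by
    rw [← not_subsingleton_iff_nontrivial, ← Group.nilpotencyClass_zero_iff_subsingleton]
    omega
  have hntQ : Nontrivial (P ⧸ Subgroup.center P) := by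
    rw [← not_subsingleton_iff_nontrivial, ← Group.nilpotencyClass_zero_iff_subsingleton]
    omega
  obtain ⟨m, hm, hmcard⟩ :=
    (hP.to_subgroup (Subgroup.center P)).nontrivial_iff_card.1 hP.center_nontrivial
  obtain ⟨n, hn, hncard⟩ :=
    (hQ.to_subgroup (Subgroup.center _)).nontrivial_iff_card.1 hQ.center_nontrivial
  have hle := IsPGroup.pow_nilpotencyClass_mul_card_center_le hp hQ (by omega)
  have hmul := Subgroup.card_eq_card_quotient_mul_card_subgroup (Subgroup.center P)
  have hle' : p ^ (k + 2 + n + m) ≤ p ^ (k + 4) := by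
    rw [pow_add, pow_add, ← hmcard, ← hncard, ← hq, show k + 4 = k + 3 + 1 from rfl, ← hk,
      ← hcard, hmul]
    exact Nat.mul_le_mul_right _ hle
  have := (Nat.pow_le_pow_iff_right hp.one_lt).1 hle'
  rw [hncard, show n = 1 by omega, pow_one]

/-- An endomorphism `f` of a nilpotent group whose displacements `x⁻¹ f(x)` commute with all
conjugates of `x` is central as soon as the center of the central quotient has prime order. -/
theorem div_mem_center_of_commute_conj {p : ℕ} (hp : p.Prime) {P : Type*} [Group P]
    [Group.IsNilpotent P] (hcard : Nat.card (Subgroup.center (P ⧸ Subgroup.center P)) = p)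
    (f : P →* P) (hf : ∀ x g : P, Commute (x⁻¹ * f x) (g⁻¹ * x * g)) (x : P) :
    x⁻¹ * f x ∈ Subgroup.center P := by
  have hfact : Fact p.Prime := ⟨hp⟩
  -- A noncentral element `w` of the second center.
  obtain ⟨w, hw, hw1⟩ :
      ∃ w : P, (w : P ⧸ Subgroup.center P) ∈ Subgroup.center (P ⧸ Subgroup.center P) ∧
        w ∉ Subgroup.center P := by
    have hne : Subgroup.center (P ⧸ Subgroup.center P) ≠ ⊥ := by
      intro h
      rw [h, Subgroup.card_bot] at hcard
      exact hp.one_lt.ne hcard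
    obtain ⟨c, hc, h1⟩ := (Subgroup.bot_or_exists_ne_one _).resolve_left hne
    obtain ⟨w, rfl⟩ := QuotientGroup.mk_surjective c
    exact ⟨w, hc, fun h => h1 ((QuotientGroup.eq_one_iff w).2 h)⟩
  have key : ∀ x : P, ¬ Commute x w → x⁻¹ * f x ∈ Subgroup.center P := by
    intro x hxw
    by_contra hd
    set C := Subgroup.centralizer (Subgroup.normalClosure {x} : Set P) with hC
    have hdC : x⁻¹ * f x ∈ C := by
      rw [hC, Subgroup.normalClosure, Subgroup.centralizer_closure, Subgroup.mem_centralizer_iff]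
      intro y hy
      simp only [Group.mem_conjugatesOfSet_iff, Set.mem_singleton_iff, exists_eq_left,
        isConj_iff] at hy
      obtain ⟨c, rfl⟩ := hy
      simpa using (hf x c⁻¹).symm.eq
    have hCn : C.Normal := inferInstance
    have hCm := hCn.map (QuotientGroup.mk' (Subgroup.center P)) (QuotientGroup.mk'_surjective _)
    obtain ⟨c, ⟨c, hcC, rfl⟩, hc1, hcZ⟩ := hCm.exists_mem_center_of_ne_bot (by
      intro hbot
      have := Subgroup.mem_map_of_mem (QuotientGroup.mk' (Subgroup.center P)) hdC
      rw [hbot, Subgroup.mem_bot] at this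
      exact hd ((QuotientGroup.eq_one_iff _).1 this))
    -- The class of `c` generates the center of `P ⧸ Z(P)`, so `w` is a power of `c` modulo `Z(P)`.
    obtain ⟨k, hk⟩ : ∃ k : ℤ, (QuotientGroup.mk' (Subgroup.center P) c) ^ k =
        QuotientGroup.mk' (Subgroup.center P) w := by
      have := mem_zpowers_of_prime_card (g := (⟨_, hcZ⟩ : Subgroup.center (P ⧸ Subgroup.center P)))
        (g' := ⟨_, hw⟩) hcard (fun h => hc1 (congrArg Subtype.val h))
      obtain ⟨k, hk⟩ := Subgroup.mem_zpowers_iff.1 this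
      exact ⟨k, congrArg Subtype.val hk⟩
    have hxc : Commute x c :=
      Subgroup.mem_centralizer_iff.1 hcC x (Subgroup.subset_normalClosure rfl)
    rw [← map_zpow] at hk
    have hz : (c ^ k)⁻¹ * w ∈ Subgroup.center P := QuotientGroup.eq.1 hk
    have hxz : Commute x ((c ^ k)⁻¹ * w) := Subgroup.mem_center_iff.1 hz x
    apply hxw
    simpa using (hxc.zpow_right k).mul_right hxz
  by_cases hxw : Commute x w
  · -- Elements commuting with `w` are quotients of two elements that do not.
    obtain ⟨t, ht⟩ : ∃ t : P, ¬ Commute t w := by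
      by_contra! hall
      exact hw1 (Subgroup.mem_center_iff.2 fun g => hall g)
    have htx : ¬ Commute (t * x) w := fun h => ht (by simpa using h.mul_left hxw.inv_left)
    have h1 := key t ht
    have h2 := key (t * x) htx
    have h3 : x⁻¹ * f x = (t⁻¹ * f t)⁻¹ * ((t * x)⁻¹ * f (t * x)) := by
      have hcomm : x⁻¹ * (t⁻¹ * f t) = t⁻¹ * f t * x⁻¹ := Subgroup.mem_center_iff.1 h1 x⁻¹
      calc x⁻¹ * f x = (t⁻¹ * f t)⁻¹ * (t⁻¹ * f t * x⁻¹) * f x := by group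
        _ = _ := by rw [← hcomm, map_mul]; group
    rw [h3]
    exact mul_mem (inv_mem h1) h2
  · exact key x hxw

/-! ### Commuting automorphisms are central -/

theorem mem_centralAut_iff {G : Type u} [Group G] {ρ : MulAut G} :
    ρ ∈ centralAut G ↔ ∀ x, x⁻¹ * ρ x ∈ Subgroup.center G := by
  refine forall_congr' fun x => ?_
  rw [eq_comm, QuotientGroup.eq]

theorem centralAut_subset_commutingAut (G : Type u) [Group G] : centralAut G ⊆ commutingAut G := by
  intro ρ hρ x
  have h : Commute x (x⁻¹ * ρ x) := Subgroup.mem_center_iff.1 (mem_centralAut_iff.1 hρ x) x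
  have h' := (Commute.refl x).mul_right h
  rw [mul_inv_cancel_left] at h'
  exact h'.symm

/-- If all Sylow subgroups are of maximal class and of order at least `p ^ 4`, then commuting
automorphisms are central: a displacement centralizes a Sylow subgroup for every prime. -/
theorem commutingAut_subset_centralAut {G : Type u} [Group G] [Finite G]
    (hmax : ∀ p : ℕ, p.Prime → p ∣ Nat.card G → ∀ P : Sylow p G,
      IsOfMaximalClass p P ∧ 4 ≤ Nat.log p (Nat.card P)) :
    commutingAut G ⊆ centralAut G := by
  intro ρ h
  have hsylow : ∀ p : ℕ, p.Prime → p ∣ Nat.card G → ∀ P : Sylow p G, ∀ x ∈ P,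
      x⁻¹ * ρ x ∈ Subgroup.center G := by
    intro p hp hdvd P x hx
    obtain ⟨hmc, hlog⟩ := hmax p hp hdvd P
    have hcent : Subgroup.centralizer {x⁻¹ * ρ x} = ⊤ := by
      refine Subgroup.eq_top_of_forall_exists_sylow_le fun q hq _ => ?_
      by_cases hpq : p = q
      · subst hpq
        refine ⟨P, fun y hy => ?_⟩
        have hmaps : ∀ z : P, ρ z ∈ (P : Subgroup G) := fun z => by
          have := mul_mem z.2 (commutingAut.div_mem_sylow h P z.2)
          rwa [mul_inv_cancel_left] at this
        let f : P →* P := (ρ.toMonoidHom.comp (P : Subgroup G).subtype).codRestrict _ hmaps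
        have := hmc.1
        have hZ := div_mem_center_of_commute_conj hp
          (hmc.card_center_quotient hp hlog) f
          (fun x g => Subtype.ext (commutingAut.commute_div_conj h (x : G) g)) ⟨x, hx⟩
        have hy' := Subgroup.mem_center_iff.1 hZ ⟨y, hy⟩
        rw [Subgroup.mem_centralizer_singleton_iff]
        exact congrArg Subtype.val hy'
      · obtain ⟨Q⟩ : Nonempty (Sylow q G) := inferInstance
        refine ⟨Q, fun y hy => ?_⟩
        obtain ⟨k, hk⟩ := P.isPGroup' ⟨x, hx⟩
        obtain ⟨l, hl⟩ := Q.isPGroup' ⟨y, hy⟩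
        rw [Subgroup.mem_centralizer_singleton_iff]
        exact (commutingAut.commute_div_of_coprime h ((Nat.coprime_primes hp hq).2 hpq)
          (congrArg Subtype.val hk) (congrArg Subtype.val hl)).symm.eq
    rw [Subgroup.mem_center_iff]
    intro g
    have hg : g ∈ Subgroup.centralizer {x⁻¹ * ρ x} := hcent ▸ Subgroup.mem_top g
    exact Subgroup.mem_centralizer_singleton_iff.1 hg
  -- The elements with the same image under `ρ` modulo the center form a subgroup.
  let π := QuotientGroup.mk' (Subgroup.center G)
  have htop : (π.comp ρ.toMonoidHom).eqLocus π = ⊤ := by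
    refine Subgroup.eq_top_of_forall_exists_sylow_le fun p hp hdvd => ?_
    obtain ⟨P⟩ : Nonempty (Sylow p G) := inferInstance
    exact ⟨P, fun x hx => (QuotientGroup.eq.2 (hsylow p hp hdvd P x hx)).symm⟩
  intro x
  exact (htop ▸ Subgroup.mem_top x : x ∈ (π.comp ρ.toMonoidHom).eqLocus π)

theorem mainTheorem9 {G₁ : Type u} {G₂ : Type v} [CommGroup G₁] [Group G₂] [Finite G₂]
    (hmax : ∀ p : ℕ, p.Prime → p ∣ Nat.card G₂ → ∀ P : Sylow p G₂,
      IsOfMaximalClass p P ∧ 4 ≤ Nat.log p (Nat.card P))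
    (ε₁ ε₂ : NormalizedTwoCocycle G₂ G₁) :
    UpperAIsomorphic ε₁ ε₂ ↔ UpperCIsomorphic ε₁ ε₂ := by
  have heq : commutingAut G₂ = centralAut G₂ :=
    (commutingAut_subset_centralAut hmax).antisymm (centralAut_subset_commutingAut G₂)
  rw [UpperAIsomorphic, UpperCIsomorphic, heq]
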